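/- Let $\mathcal X=[0,1]^d$ and let $p$ be a probability density on $\mathcal X$ (for instance the uniform one, $p\equiv 1$). Fix hyperparameters $\theta=(s^2,\ell_1,\dots,\ell_d,\sigma^2)$, all strictly positive, the kernel $k(x,x')=s^2\exp\bigl(-\tfrac12\sum_{j=1}^d (x_j-x'_j)^2/\ell_j^2\bigr)$, data $D_n=(X_n,Y_n)$ consisting of designs $x_1,\dots,x_n\in\mathcal X$ and observations $Y_n=(y_1,\dots,y_n)\in\mathbb R^n$ with Gaussian noise of variance $\sigma^2$, and a further design $\tilde x\in\mathcal X$. Put $K_n=(k(x_i,x_j))_{ij}$, $k_n(x)=(k(x,x_1),\dots,k(x,x_n))^T$ and $$m_n(x)=k_n(x)^T(K_n+\sigma^2I)^{-1}Y_n,\qquad k_n(x,x')=k(x,x')-k_n(x)^T(K_n+\sigma^2I)^{-1}k_n(x'),\qquad \sigma_n^2(x)=k_n(x,x),$$ the mean function, covariance function and variance of the posterior Gaussian process given $D_n$. For a hypothetical observation $\tilde y\in\mathbb R$ at $\tilde x$ let $\tilde m_{n+1}$ and $\tilde k_{n+1}$ be the same functions for the data $D_n$ enlarged by $(\tilde x,\tilde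 y)$. Let $Q[f]=\int_{\mathcal X}f(x)p(x)\,dx$, and put $$\mu_1=\int m_n\,p,\quad \sigma_1^2=\iint k_n(x,x')p(x)p(x')\,dx\,dx',\quad \mu_2(\tilde y)=\int\tilde m_{n+1}\,p,\quad \sigma_2^2=\iint\tilde k_{n+1}(x,x')p(x)p(x')\,dx\,dx'$$ ($\sigma_2^2=\sigma_2^2(\tilde x)$ does not depend on $\tilde y$), $\varepsilon(x)=\int k(x,x')p(x')\,dx'$, $\varepsilon_n=(\varepsilon(x_1),\dots,\varepsilon(x_n))^T$ and $$\nu(\tilde x)=\varepsilon(\tilde x)-\varepsilon_n^T(K_n+\sigma^2I)^{-1}k_n(\tilde x).$$ Then: 1. If $f$ is a jointly measurable Gaussian process on $\mathcal X$ with mean $m_n$ and covariance $k_n$, then $Q[f]$ has law $\mathcal N(\mu_1,\sigma_1^2)$ (the current belief about $Q$); if it has mean $\tilde m_{n+1}$ and covariance $\tilde k_{n+1}$, then $Q[f]$ has law $\mathcal N(\mu_2(\tilde y),\sigma_2^2)$ (the hypothetical belief about $Q$). Moreover $\sigma_1^2>0$, $\sigma_2^2>0$ and $\sigma_n^2(\tilde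 x)\ge 0$. 2. For every $\tilde y\in\mathbb R$ the divergence $G(\tilde x,\tilde y;\theta)=\mathrm{KL}\bigl(\mathcal N(\mu_2(\tilde y),\sigma_2^2)\,\|\,\mathcal N(\mu_1,\sigma_1^2)\bigr)$ is finite and $$G(\tilde x,\tilde y;\theta)=\log\frac{\sigma_1}{\sigma_2}+\frac{\sigma_2^2}{2\sigma_1^2}+\frac{(\mu_2(\tilde y)-\mu_1)^2}{2\sigma_1^2}-\frac12,\qquad \mu_2(\tilde y)=\mu_1+\frac{\nu(\tilde x)}{\sigma_n^2(\tilde x)+\sigma^2}\bigl(\tilde y-m_n(\tilde x)\bigr),$$ so it is a polynomial of degree at most two in $\tilde y$. 3. Let $\tilde y$ be distributed according to the Gaussian predictive law, given $D_n$, of the noisy observation at $\tilde x$, that is, as the sum of independent $\mathcal N(m_n(\tilde x),\sigma_n^2(\tilde x))$ and $\mathcal N(0,\sigma^2)$ variables. Then $G(\tilde x,\tilde y;\theta)$ is integrable, and the expected information gain $G(\tilde x;\theta)=\mathbb E_{\tilde y}[G(\tilde x,\tilde y;\theta)]$ is $$G(\tilde x;\theta)=\log\frac{\sigma_1}{\sigma_2(\tilde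 x)}+\frac{\sigma_2^2(\tilde x)}{2\sigma_1^2}-\frac12+\frac{\nu(\tilde x)^2}{2\sigma_1^2\,(\sigma_n^2(\tilde x)+\sigma^2)}.$$ -/

import Mathlib

open MeasureTheory ProbabilityTheory Matrix

noncomputable section

namespace BODE

/-- The input domain `[0,1]^d`. Its `volume` is the uniform (product Lebesgue) probability measure. -/
abbrev Cube (d : ℕ) : Type := Fin d → unitInterval

/-- Probability density functions on the cube with respect to Lebesgue measure. -/
structure IsPdf {d : ℕ} (p : Cube d → ℝ) : Prop where
  nonneg : ∀ x, 0 ≤ p x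
  integral_eq_one : ∫ x, p x = 1

/-- Hyperparameters: signal strength `s²`, lengthscales `ℓ_j`, noise variance `σ²`. -/
structure Hyper (d : ℕ) where
  signalVar : ℝ
  lengthscale : Fin d → ℝ
  noiseVar : ℝ
  signalVar_pos : 0 < signalVar
  lengthscale_pos : ∀ j, 0 < lengthscale j
  noiseVar_pos : 0 < noiseVar

variable {d n : ℕ}

/-- The squared exponential covariance function
`k(x,x') = s² exp(-½ ∑_j (x_j - x'_j)² / ℓ_j²)`. -/
def kernel (θ : Hyper d) (x x' : Cube d) : ℝ :=
  θ.signalVar *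
    Real.exp (-(1 / 2) * ∑ j, ((x j : ℝ) - (x' j : ℝ)) ^ 2 / θ.lengthscale j ^ 2)

/-- The matrix `K_n + σ² I_n`. -/
def noisyGram (θ : Hyper d) (X : Fin n → Cube d) : Matrix (Fin n) (Fin n) ℝ :=
  Matrix.of (fun i j => kernel θ (X i) (X j)) + θ.noiseVar • (1 : Matrix (Fin n) (Fin n) ℝ)

/-- The vector `k_n(x) = (k(x,x_1), …, k(x,x_n))`. -/
def crossCov (θ : Hyper d) (X : Fin n → Cube d) (x : Cube d) : Fin n → ℝ :=
  fun i => kernel θ x (X i)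

/-- The posterior mean `m_n(x) = k_n(x)ᵀ (K_n + σ² I)⁻¹ Y_n`. -/
def postMean (θ : Hyper d) (X : Fin n → Cube d) (Y : Fin n → ℝ) (x : Cube d) : ℝ :=
  crossCov θ X x ⬝ᵥ ((noisyGram θ X)⁻¹ *ᵥ Y)

/-- The posterior covariance `k_n(x,x') = k(x,x') - k_n(x)ᵀ (K_n + σ² I)⁻¹ k_n(x')`. -/
def postCov (θ : Hyper d) (X : Fin n → Cube d) (x x' : Cube d) : ℝ :=
  kernel θ x x' - crossCov θ X x ⬝ᵥ ((noisyGram θ X)⁻¹ *ᵥ crossCov θ X x')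

/-- The field `f`, on the probability space `(Ω, P)`, is a (jointly measurable) Gaussian process on
the cube with mean function `m` and covariance function `k`. -/
structure IsGP {Ω : Type*} [MeasurableSpace Ω] (P : Measure Ω) (f : Cube d → Ω → ℝ)
    (m : Cube d → ℝ) (k : Cube d → Cube d → ℝ) : Prop where
  gaussian : IsGaussianProcess f P
  measurable : Measurable (Function.uncurry f)
  mean_eq : ∀ x, ∫ ω, f x ω ∂P = m x
  cov_eq : ∀ x x', cov[f x, f x'; P] = k x x'

/-- The quantity of interest `Q[g] = ∫ g(x) p(x) dx`. -/
def qoi (p g : Cube d → ℝ) : ℝ := ∫ x, g x * p x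

/-- The mean `∫ m_n(x) p(x) dx` of the belief about `Q` given the data `(X, Y)`. -/
def qoiMean (θ : Hyper d) (p : Cube d → ℝ) (X : Fin n → Cube d) (Y : Fin n → ℝ) : ℝ :=
  qoi p (postMean θ X Y)

/-- The variance `∫∫ k_n(x,x') p(x) p(x') dx dx'` of the belief about `Q` given the data. -/
def qoiVar (θ : Hyper d) (p : Cube d → ℝ) (X : Fin n → Cube d) : ℝ :=
  ∫ x, ∫ x', postCov θ X x x' * p x * p x'

/-- The standard deviation of the belief about `Q` given the data. -/
def qoiSd (θ : Hyper d) (p : Cube d → ℝ) (X : Fin n → Cube d) : ℝ :=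
  √(qoiVar θ p X)

/-- The Gaussian belief `p(Q | θ, D)` about the quantity of interest given data `D = (X, Y)`. -/
def qoiBelief (θ : Hyper d) (p : Cube d → ℝ) (X : Fin n → Cube d) (Y : Fin n → ℝ) : Measure ℝ :=
  gaussianReal (qoiMean θ p X Y) (qoiVar θ p X).toNNReal

/-- The designs `x_1, …, x_n, x̃`. -/
def addDesign (X : Fin n → Cube d) (xt : Cube d) : Fin (n + 1) → Cube d :=
  Fin.snoc (α := fun _ => Cube d) X xt

/-- The observations `y_1, …, y_n, ỹ`. -/
def addObs (Y : Fin n → ℝ) (yt : ℝ) : Fin (n + 1) → ℝ :=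
  Fin.snoc (α := fun _ => ℝ) Y yt

/-- The predictive law of the hypothetical observation `ỹ = f(x̃) + noise`: the Gaussian posterior
`N(m_n(x̃), σ_n²(x̃))` of `f(x̃)`, with `σ_n²(x̃) = k_n(x̃,x̃)`, convolved with the independent
observation noise `N(0, σ²)`. -/
def predictive (θ : Hyper d) (X : Fin n → Cube d) (Y : Fin n → ℝ) (xt : Cube d) : Measure ℝ :=
  (gaussianReal (postMean θ X Y xt) (postCov θ X xt xt).toNNReal).conv
    (gaussianReal 0 θ.noiseVar.toNNReal)

/-- The Kullback-Leibler divergence of the hypothetical belief from the current one, in `[0,∞]`. -/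
def infoDiv (θ : Hyper d) (p : Cube d → ℝ) (X : Fin n → Cube d) (Y : Fin n → ℝ)
    (xt : Cube d) (yt : ℝ) : ENNReal :=
  InformationTheory.klDiv (qoiBelief θ p (addDesign X xt) (addObs Y yt)) (qoiBelief θ p X Y)

/-- The information gain `G(x̃, ỹ; θ)`. -/
def infoGain (θ : Hyper d) (p : Cube d → ℝ) (X : Fin n → Cube d) (Y : Fin n → ℝ)
    (xt : Cube d) (yt : ℝ) : ℝ :=
  (infoDiv θ p X Y xt yt).toReal

/-- The expected information gain `G(x̃; θ) = ∫ G(x̃, ỹ; θ) p(ỹ | x̃, θ, D_n) dỹ`. -/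
def expectedInfoGain (θ : Hyper d) (p : Cube d → ℝ) (X : Fin n → Cube d) (Y : Fin n → ℝ)
    (xt : Cube d) : ℝ :=
  ∫ yt, infoGain θ p X Y xt yt ∂(predictive θ X Y xt)

/-- `ε(x) = ∫ k(x,x') p(x') dx'`. -/
def kernelMean (θ : Hyper d) (p : Cube d → ℝ) (x : Cube d) : ℝ :=
  ∫ x', kernel θ x x' * p x'

/-- `ν(x̃) = ε(x̃) - ε_nᵀ (K_n + σ² I)⁻¹ k_n(x̃)`, where `ε_n = (ε(x_1), …, ε(x_n))`. -/
def nu (θ : Hyper d) (p : Cube d → ℝ) (X : Fin n → Cube d) (xt : Cube d) : ℝ :=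
  kernelMean θ p xt -
    (fun i => kernelMean θ p (X i)) ⬝ᵥ ((noisyGram θ X)⁻¹ *ᵥ crossCov θ X xt)

end BODE

end

/-! ### Feature map of the kernel and regression residuals. -/

namespace BODE

variable {d n : ℕ}

/-! The kernel is the Gram kernel of Gaussian bumps in `L²(ℝ^d)`, so `M = K_n + σ²I` is positive
definite. Both `σ_n²(x)` and `σ_1²` have the form `‖v‖² - bᵀM⁻¹b`, with `v` the feature of `x`,
respectively the kernel mean embedding of `p`, and `b` its inner products with the design features.
With `c = M⁻¹b`, nonnegativity of `‖v - ∑ c_i φ(x_i)‖²` bounds this below by `σ²|c|²`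
(`noiseVar_mul_dotProduct_le_residual`). Hence `σ_n² ≥ 0`; and `σ_1² > 0`, because `c = 0` leaves
`‖v‖²`, which is nonzero as the kernel is strictly positive.

`Q[f]` is Gaussian as an `L¹` limit of finite linear combinations of values of `f`
(`IsGaussianProcess.map_integral`): simple functions approximate the identity of the compact cube,
and continuity of the mean and covariance controls the error.

The gain is the integrated log density ratio of two Gaussians (`toReal_klDiv_gaussianReal`). Solving
the bordered linear system makes `μ_2(ỹ)` affine in `ỹ` (`postMean_addDesign`), so the gain is a
constant plus a multiple of `(ỹ - m_n(x̃))²`, whose predictive expectation is `σ_n²(x̃) + σ²`. -/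

theorem integrable_exp_neg_sub_sq_div (a : ℝ) {l : ℝ} (hl : 0 < l) :
    Integrable (fun z : ℝ => Real.exp (-(a - z) ^ 2 / l ^ 2)) := by
  have h := (integrable_exp_neg_mul_sq (b := 1 / l ^ 2) (by positivity)).comp_sub_left a
  refine h.congr (Filter.Eventually.of_forall fun z => ?_)
  dsimp only
  congr 1
  ring

/-- Completing the square about the midpoint of `a` and `b`: the cross term left over is exactly one
factor of the squared exponential kernel. -/
theorem integral_exp_neg_sub_sq_mul (a b : ℝ) {l : ℝ} (hl : 0 < l) :
    ∫ z : ℝ, Real.exp (-(a - z) ^ 2 / l ^ 2) * Real.exp (-(b - z) ^ 2 / l ^ 2) =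
      √(Real.pi / (2 / l ^ 2)) * Real.exp (-(1 / 2) * ((a - b) ^ 2 / l ^ 2)) := by
  have h : ∀ z : ℝ, Real.exp (-(a - z) ^ 2 / l ^ 2) * Real.exp (-(b - z) ^ 2 / l ^ 2) =
      Real.exp (-(2 / l ^ 2) * ((a + b) / 2 - z) ^ 2) *
        Real.exp (-(1 / 2) * ((a - b) ^ 2 / l ^ 2)) := by
    intro z
    rw [← Real.exp_add, ← Real.exp_add]
    congr 1
    field_simp
    ring
  simp_rw [h]
  rw [integral_mul_const,
    integral_sub_left_eq_self (fun z : ℝ => Real.exp (-(2 / l ^ 2) * z ^ 2)) volume ((a + b) / 2),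
    integral_gaussian]

/-- The Gaussian bump centred at `x` whose `L²` inner products are the values of the kernel. -/
noncomputable def bump (θ : Hyper d) (x : Cube d) (z : Fin d → ℝ) : ℝ :=
  √(θ.signalVar / ∏ j, √(Real.pi / (2 / θ.lengthscale j ^ 2))) *
    ∏ j, Real.exp (-((x j : ℝ) - z j) ^ 2 / θ.lengthscale j ^ 2)

theorem continuous_bump (θ : Hyper d) (x : Cube d) : Continuous (bump θ x) := by
  unfold bump
  fun_prop

theorem bump_mul_bump (θ : Hyper d) (x y : Cube d) (z : Fin d → ℝ) :
    bump θ x z * bump θ y z = (θ.signalVar / ∏ j, √(Real.pi / (2 / θ.lengthscale j ^ 2))) *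
      ∏ j, (Real.exp (-((x j : ℝ) - z j) ^ 2 / θ.lengthscale j ^ 2) *
        Real.exp (-((y j : ℝ) - z j) ^ 2 / θ.lengthscale j ^ 2)) := by
  have h : 0 ≤ θ.signalVar / ∏ j, √(Real.pi / (2 / θ.lengthscale j ^ 2)) :=
    div_nonneg θ.signalVar_pos.le (Finset.prod_nonneg fun j _ => Real.sqrt_nonneg _)
  rw [bump, bump, Finset.prod_mul_distrib, mul_mul_mul_comm, Real.mul_self_sqrt h]

/-- Fubini splits the integral over coordinates, and the normalisation in `bump` cancels the product
of one-dimensional Gaussian integrals. -/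
theorem integral_bump_mul_bump (θ : Hyper d) (x y : Cube d) :
    ∫ z, bump θ x z * bump θ y z = kernel θ x y := by
  simp_rw [bump_mul_bump]
  rw [integral_const_mul, integral_fintype_prod_volume_eq_prod (fun j (z : ℝ) =>
    Real.exp (-((x j : ℝ) - z) ^ 2 / θ.lengthscale j ^ 2) *
      Real.exp (-((y j : ℝ) - z) ^ 2 / θ.lengthscale j ^ 2))]
  simp_rw [integral_exp_neg_sub_sq_mul _ _ (θ.lengthscale_pos _)]
  have h : ∏ j, √(Real.pi / (2 / θ.lengthscale j ^ 2)) ≠ 0 := by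
    refine Finset.prod_ne_zero_iff.mpr fun j _ => ?_
    have := θ.lengthscale_pos j
    positivity
  rw [Finset.prod_mul_distrib, kernel, ← Real.exp_sum, ← Finset.mul_sum, ← mul_assoc,
    div_mul_cancel₀ _ h]

theorem memLp_bump (θ : Hyper d) (x : Cube d) : MemLp (bump θ x) 2 := by
  rw [memLp_two_iff_integrable_sq (continuous_bump θ x).aestronglyMeasurable]
  simp_rw [sq, bump_mul_bump]
  refine Integrable.const_mul (Integrable.fintype_prod (f := fun j (z : ℝ) =>
    Real.exp (-((x j : ℝ) - z) ^ 2 / θ.lengthscale j ^ 2) *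
      Real.exp (-((x j : ℝ) - z) ^ 2 / θ.lengthscale j ^ 2)) fun j => ?_) _
  refine (integrable_exp_neg_sub_sq_div (x j) (θ.lengthscale_pos j)).mul_bdd (c := 1)
    (by fun_prop) (Filter.Eventually.of_forall fun z => ?_)
  rw [Real.norm_eq_abs, Real.abs_exp, Real.exp_le_one_iff]
  exact div_nonpos_of_nonpos_of_nonneg (neg_nonpos.mpr (sq_nonneg _)) (sq_nonneg _)

/-- A feature map of the kernel into a Hilbert space. -/
noncomputable def feature (θ : Hyper d) (x : Cube d) : Lp ℝ 2 (volume : Measure (Fin d → ℝ)) :=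
  (memLp_bump θ x).toLp

theorem inner_feature (θ : Hyper d) (x y : Cube d) :
    inner ℝ (feature θ x) (feature θ y) = kernel θ x y := by
  rw [L2.inner_def, ← integral_bump_mul_bump]
  refine integral_congr_ae ?_
  filter_upwards [(memLp_bump θ x).coeFn_toLp, (memLp_bump θ y).coeFn_toLp] with z hx hy
  simp only [feature, hx, hy]
  simp [mul_comm]

theorem kernel_comm (θ : Hyper d) (x y : Cube d) : kernel θ x y = kernel θ y x := by
  simp only [kernel, sub_sq_comm]

theorem kernel_pos (θ : Hyper d) (x y : Cube d) : 0 < kernel θ x y :=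
  mul_pos θ.signalVar_pos (Real.exp_pos _)

theorem continuous_kernel (θ : Hyper d) :
    Continuous (fun q : Cube d × Cube d => kernel θ q.1 q.2) := by
  unfold kernel
  fun_prop

/-- The squared distance of two features is a combination of kernel values. Continuity makes the
feature map Bochner integrable, as `meanFeature` requires. -/
theorem continuous_feature (θ : Hyper d) : Continuous (feature θ) := by
  refine continuous_iff_continuousAt.mpr fun x => ?_
  rw [ContinuousAt, tendsto_iff_norm_sub_tendsto_zero]
  have h : ∀ y, ‖feature θ y - feature θ x‖ =
      √(kernel θ y y - 2 * kernel θ y x + kernel θ x x) := by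
    intro y
    rw [← inner_feature, ← inner_feature, ← inner_feature, real_inner_self_eq_norm_sq,
      real_inner_self_eq_norm_sq, ← norm_sub_sq_real, Real.sqrt_sq (norm_nonneg _)]
  simp_rw [h]
  have hc : Continuous fun y => √(kernel θ y y - 2 * kernel θ y x + kernel θ x x) := by
    have h1 := (continuous_kernel θ).comp (continuous_id.prodMk continuous_id)
    have h2 := (continuous_kernel θ).comp (continuous_id.prodMk (continuous_const (y := x)))
    exact ((h1.sub (h2.const_mul 2)).add continuous_const).sqrt
  refine (hc.tendsto x).trans (le_of_eq ?_)
  congr 1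
  rw [Real.sqrt_eq_zero']
  linarith

theorem noisyGram_eq (θ : Hyper d) (X : Fin n → Cube d) :
    noisyGram θ X = gram ℝ (fun i => feature θ (X i)) + θ.noiseVar • 1 := by
  ext i j
  simp [noisyGram, inner_feature]

theorem posDef_noisyGram (θ : Hyper d) (X : Fin n → Cube d) : (noisyGram θ X).PosDef := by
  rw [noisyGram_eq]
  exact PosDef.posSemidef_add (posSemidef_gram ℝ _) (PosDef.one.smul θ.noiseVar_pos)

theorem isUnit_det_noisyGram (θ : Hyper d) (X : Fin n → Cube d) : IsUnit (noisyGram θ X).det :=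
  (posDef_noisyGram θ X).det_pos.ne'.isUnit

theorem noisyGram_mulVec_inv_mulVec (θ : Hyper d) (X : Fin n → Cube d) (b : Fin n → ℝ) :
    noisyGram θ X *ᵥ ((noisyGram θ X)⁻¹ *ᵥ b) = b := by
  rw [mulVec_mulVec, mul_nonsing_inv _ (isUnit_det_noisyGram θ X), one_mulVec]

/-- Conditioning a vector `v` of the feature space on the noisy features leaves a residual variance
which dominates the squared norm of the regression weights. -/
theorem noiseVar_mul_dotProduct_le_residual (θ : Hyper d) (X : Fin n → Cube d)
    (v : Lp ℝ 2 (volume : Measure (Fin d → ℝ))) (b : Fin n → ℝ)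
    (hb : ∀ i, b i = inner ℝ (feature θ (X i)) v) :
    θ.noiseVar * (((noisyGram θ X)⁻¹ *ᵥ b) ⬝ᵥ ((noisyGram θ X)⁻¹ *ᵥ b)) ≤
      inner ℝ v v - b ⬝ᵥ ((noisyGram θ X)⁻¹ *ᵥ b) := by
  have hM := noisyGram_mulVec_inv_mulVec θ X b
  set c := (noisyGram θ X)⁻¹ *ᵥ b with hc
  have h1 : inner ℝ (∑ i, c i • feature θ (X i)) v = b ⬝ᵥ c := by
    simp only [sum_inner, real_inner_smul_left, dotProduct, hb]
    exact Finset.sum_congr rfl fun i _ => mul_comm _ _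
  -- The Gram matrix is `M - σ²I`, and `M c = b`.
  have h2 : inner ℝ (∑ i, c i • feature θ (X i)) (∑ i, c i • feature θ (X i)) =
      b ⬝ᵥ c - θ.noiseVar * (c ⬝ᵥ c) := by
    have h : c ⬝ᵥ b = c ⬝ᵥ (noisyGram θ X *ᵥ c) := by rw [hM]
    rw [← star_dotProduct_gram_mulVec, eq_sub_iff_add_eq, dotProduct_comm b, h,
      noisyGram_eq, add_mulVec, dotProduct_add, smul_mulVec, one_mulVec, dotProduct_smul]
    simp
  have h3 := real_inner_self_nonneg (x := v - ∑ i, c i • feature θ (X i))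
  rw [real_inner_sub_sub_self, real_inner_comm (∑ i, c i • feature θ (X i)) v, h1, h2] at h3
  linarith

theorem postCov_self_nonneg (θ : Hyper d) (X : Fin n → Cube d) (x : Cube d) :
    0 ≤ postCov θ X x x := by
  have h := noiseVar_mul_dotProduct_le_residual θ X (feature θ x) (crossCov θ X x) (fun i => by
    rw [inner_feature, crossCov, kernel_comm])
  rw [inner_feature] at h
  have h0 (c : Fin n → ℝ) : 0 ≤ c ⬝ᵥ c := Finset.sum_nonneg fun i _ => mul_self_nonneg _
  rw [postCov]
  have h1 := mul_nonneg θ.noiseVar_pos.le (h0 ((noisyGram θ X)⁻¹ *ᵥ crossCov θ X x))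
  exact h1.trans h

theorem continuous_crossCov (θ : Hyper d) (X : Fin n → Cube d) : Continuous (crossCov θ X) := by
  unfold crossCov kernel
  fun_prop

theorem continuous_postMean (θ : Hyper d) (X : Fin n → Cube d) (Y : Fin n → ℝ) :
    Continuous (postMean θ X Y) :=
  (continuous_crossCov θ X).dotProduct continuous_const

theorem continuous_postCov (θ : Hyper d) (X : Fin n → Cube d) :
    Continuous (fun q : Cube d × Cube d => postCov θ X q.1 q.2) :=
  (continuous_kernel θ).sub (((continuous_crossCov θ X).comp continuous_fst).dotProduct
    (continuous_const.matrix_mulVec ((continuous_crossCov θ X).comp continuous_snd)))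

end BODE

/-! ### Simple-function integrals and stability of characteristic functions. -/

namespace MeasureTheory

open Filter

theorem integral_comp_simpleFunc {T F : Type*} [MeasurableSpace T]
    [NormedAddCommGroup F] [NormedSpace ℝ F] [CompleteSpace F]
    (μ : Measure T) [IsFiniteMeasure μ] (s : SimpleFunc T T) (g : T → F) :
    ∫ x, g (s x) ∂μ = ∑ y ∈ s.range, μ.real (s ⁻¹' {y}) • g y := by
  have h1 : ∀ x, g (s x) = ∑ y ∈ s.range, (s ⁻¹' {y}).indicator (fun _ => g y) x := by
    intro x
    rw [Finset.sum_eq_single (s x)]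
    · simp
    · intro y _ hy
      simp [Set.indicator, hy.symm]
    · intro h
      exact absurd (s.mem_range_self x) h
  simp_rw [h1]
  rw [integral_finsetSum _ fun y _ => (integrable_const _).indicator (s.measurableSet_fiber y)]
  simp_rw [integral_indicator_const _ (s.measurableSet_fiber _)]

/-- From `|e^{ia} - 1| ≤ |a|`: `L¹` convergence of random variables gives pointwise convergence of
characteristic functions. -/
theorem norm_charFun_map_sub_le {Ω : Type*} [MeasurableSpace Ω] {P : Measure Ω}
    [IsProbabilityMeasure P] {U V : Ω → ℝ} (hU : Integrable U P) (hV : Integrable V P) (t : ℝ) :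
    ‖charFun (P.map U) t - charFun (P.map V) t‖ ≤ |t| * ∫ ω, |U ω - V ω| ∂P := by
  have hexp {W : Ω → ℝ} (hW : Integrable W P) :
      Integrable (fun ω => Complex.exp (t * W ω * Complex.I)) P := by
    refine (integrable_const (1 : ℝ)).mono' ?_ (.of_forall fun ω => ?_)
    · have := hW.aemeasurable
      exact AEMeasurable.aestronglyMeasurable (by fun_prop)
    · rw [← Complex.ofReal_mul, Complex.norm_exp_ofReal_mul_I]
  have hchar {W : Ω → ℝ} (hW : Integrable W P) :
      charFun (P.map W) t = ∫ ω, Complex.exp (t * W ω * Complex.I) ∂P := by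
    rw [charFun_apply_real, integral_map hW.aemeasurable
      (Continuous.aestronglyMeasurable (by fun_prop))]
  rw [hchar hU, hchar hV, ← integral_sub (hexp hU) (hexp hV), ← integral_const_mul]
  refine norm_integral_le_of_norm_le ((hU.sub hV).abs.const_mul |t|)
    (.of_forall fun ω => ?_)
  have h1 : Complex.exp (t * U ω * Complex.I) - Complex.exp (t * V ω * Complex.I) =
      Complex.exp (t * V ω * Complex.I) *
        (Complex.exp (Complex.I * (t * (U ω - V ω) : ℝ)) - 1) := by
    rw [mul_sub, ← Complex.exp_add, mul_one]
    congr 2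
    push_cast
    ring
  rw [h1, norm_mul, ← Complex.ofReal_mul, Complex.norm_exp_ofReal_mul_I, one_mul]
  refine (Real.norm_exp_I_mul_ofReal_sub_one_le).trans (le_of_eq ?_)
  rw [Real.norm_eq_abs, abs_mul]

end MeasureTheory

/-! ### Integrals of Gaussian processes. -/

namespace ProbabilityTheory

open Filter
open scoped Topology

section IntegralOfGaussianProcess

variable {Ω T : Type*} [MeasurableSpace Ω] {P : Measure Ω}
  {f : T → Ω → ℝ} {m : T → ℝ} {k : T → T → ℝ}

theorem IsGaussianProcess.memLp_two (hf : IsGaussianProcess f P) (x : T) : MemLp (f x) 2 P :=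
  (hf.hasGaussianLaw_eval x).memLp_two

theorem IsGaussianProcess.integral_abs_sub_le (hf : IsGaussianProcess f P)
    (hm : ∀ x, ∫ ω, f x ω ∂P = m x) (hk : ∀ x y, cov[f x, f y; P] = k x y) (x y : T) :
    ∫ ω, |f x ω - f y ω| ∂P ≤ √(k x x - 2 * k x y + k y y + (m x - m y) ^ 2) := by
  have := hf.isProbabilityMeasure
  have hx := hf.memLp_two x
  have hy := hf.memLp_two y
  have hd : MemLp (fun ω => f x ω - f y ω) 2 P := hx.sub hy
  have h1 := variance_eq_sub hd
  have h2 : Var[fun ω => f x ω - f y ω; P] = k x x - 2 * k x y + k y y := by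
    rw [variance_fun_sub hx hy, ← covariance_self hx.aemeasurable,
      ← covariance_self hy.aemeasurable, hk, hk, hk]
  have h3 : ∫ ω, (f x ω - f y ω) ∂P = m x - m y := by
    rw [integral_sub (hx.integrable one_le_two) (hy.integrable one_le_two), hm, hm]
  -- Jensen's inequality, read off from nonnegativity of the variance of the absolute increment.
  have h4 : (∫ ω, |f x ω - f y ω| ∂P) ^ 2 ≤ ∫ ω, (f x ω - f y ω) ^ 2 ∂P := by
    have h := variance_nonneg (fun ω => |f x ω - f y ω|) P
    rw [variance_eq_sub (by simpa using hd.norm)] at h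
    simpa using h
  refine Real.le_sqrt_of_sq_le (h4.trans (le_of_eq ?_))
  rw [h2, h3] at h1
  simp only [Pi.pow_apply] at h1
  linarith

variable [MeasurableSpace T]

/-- The law of a simple-function approximation of the integral of a Gaussian process. -/
theorem IsGaussianProcess.map_integral_comp_simpleFunc (hf : IsGaussianProcess f P)
    (hm : ∀ x, ∫ ω, f x ω ∂P = m x) (hk : ∀ x y, cov[f x, f y; P] = k x y)
    (μ : Measure T) [IsFiniteMeasure μ] (s : SimpleFunc T T) :
    P.map (fun ω => ∫ x, f (s x) ω ∂μ) =
      gaussianReal (∫ x, m (s x) ∂μ) (∫ x, ∫ y, k (s x) (s y) ∂μ ∂μ).toNNReal := by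
  have := hf.isProbabilityMeasure
  have hint (ω : Ω) : ∫ x, f (s x) ω ∂μ = ∑ y ∈ s.range, μ.real (s ⁻¹' {y}) • f y ω :=
    integral_comp_simpleFunc μ s fun x => f x ω
  simp_rw [hint]
  have hg := hf.smul fun y => μ.real (s ⁻¹' {y})
  have hL2 : ∀ y ∈ s.range, MemLp (fun ω => μ.real (s ⁻¹' {y}) • f y ω) 2 P :=
    fun y _ => hg.memLp_two y
  rw [(hg.hasGaussianLaw_fun_sum (I := s.range)).map_eq_gaussianReal]
  congr 2
  · rw [integral_comp_simpleFunc μ s m,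
      integral_finsetSum _ fun y hy => (hL2 y hy).integrable one_le_two]
    simp_rw [integral_smul, hm]
  · rw [variance_fun_sum' hL2, integral_comp_simpleFunc μ s fun x => ∫ y, k x (s y) ∂μ]
    refine Finset.sum_congr rfl fun x _ => ?_
    rw [integral_comp_simpleFunc μ s (k x), Finset.smul_sum]
    refine Finset.sum_congr rfl fun y _ => ?_
    simp only [smul_eq_mul]
    rw [covariance_const_mul_left, covariance_const_mul_right, hk]

/-- The first absolute moment at `x` is at most `√(k x x + m x ^ 2)`, which is continuous, hence
integrable on a compact space. This licenses Fubini. -/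
theorem IsGaussianProcess.integrable_prod [TopologicalSpace T] [CompactSpace T]
    [OpensMeasurableSpace T] (hf : IsGaussianProcess f P)
    (hmeas : Measurable (Function.uncurry f))
    (hm : ∀ x, ∫ ω, f x ω ∂P = m x) (hk : ∀ x y, cov[f x, f y; P] = k x y)
    (hmc : Continuous m) (hkc : Continuous fun q : T × T => k q.1 q.2)
    (μ : Measure T) [IsFiniteMeasure μ] :
    Integrable (Function.uncurry f) (μ.prod P) := by
  have := hf.isProbabilityMeasure
  rw [integrable_prod_iff hmeas.aestronglyMeasurable]
  refine ⟨.of_forall fun x => (hf.memLp_two x).integrable one_le_two, ?_⟩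
  have hc : Continuous fun x => √(k x x + (m x) ^ 2) :=
    ((hkc.comp (continuous_id.prodMk continuous_id)).add (hmc.pow 2)).sqrt
  refine (hc.integrable_of_hasCompactSupport (HasCompactSupport.of_compactSpace _)).mono'
    (hmeas.aestronglyMeasurable.norm.integral_prod_right') (.of_forall fun x => ?_)
  have hx := hf.memLp_two x
  have h1 := variance_nonneg (fun ω => |f x ω|) P
  have h2 := variance_eq_sub hx
  rw [variance_eq_sub (by simpa using hx.norm)] at h1
  rw [← covariance_self hx.aemeasurable, hk, hm] at h2
  simp only [Pi.pow_apply, sq_abs] at h1 h2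
  rw [Real.norm_of_nonneg (integral_nonneg fun _ => norm_nonneg _)]
  refine Real.le_sqrt_of_sq_le ?_
  simp only [Function.uncurry, Real.norm_eq_abs]
  linarith

/-- Dominated convergence. A function of the pair covers both the increment bound and, by ignoring
the first coordinate, the mean. -/
theorem tendsto_integral_diag_approx [PseudoMetricSpace T] [CompactSpace T] [BorelSpace T]
    (μ : Measure T) [IsFiniteMeasure μ] {s : ℕ → SimpleFunc T T}
    (hs : ∀ x, Tendsto (fun N => s N x) atTop (𝓝 x)) {g : T × T → ℝ} (hg : Continuous g) :
    Tendsto (fun N => ∫ x, g (x, s N x) ∂μ) atTop (𝓝 (∫ x, g (x, x) ∂μ)) := by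
  obtain ⟨C, hC⟩ := isCompact_univ.exists_bound_of_continuousOn hg.continuousOn
  refine tendsto_integral_of_dominated_convergence (fun _ => C) (fun N => ?_)
    (integrable_const C) (fun N => .of_forall fun x => hC _ (Set.mem_univ _))
    (.of_forall fun x => ?_)
  · exact (hg.measurable.comp (measurable_id.prodMk (s N).measurable)).aestronglyMeasurable
  · exact (hg.tendsto (x, x)).comp (tendsto_const_nhds.prodMk_nhds (hs x))

theorem tendsto_integral_integral_approx [PseudoMetricSpace T] [CompactSpace T] [BorelSpace T]
    (μ : Measure T) [IsFiniteMeasure μ] {s : ℕ → SimpleFunc T T}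
    (hs : ∀ x, Tendsto (fun N => s N x) atTop (𝓝 x))
    (hkc : Continuous fun q : T × T => k q.1 q.2) :
    Tendsto (fun N => ∫ x, ∫ y, k (s N x) (s N y) ∂μ ∂μ) atTop (𝓝 (∫ x, ∫ y, k x y ∂μ ∂μ)) := by
  obtain ⟨C, hC⟩ := isCompact_univ.exists_bound_of_continuousOn hkc.continuousOn
  have hmeas (N : ℕ) : StronglyMeasurable fun q : T × T => k (s N q.1) (s N q.2) :=
    (hkc.measurable.comp (((s N).measurable.comp measurable_fst).prodMk
      ((s N).measurable.comp measurable_snd))).stronglyMeasurable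
  refine tendsto_integral_of_dominated_convergence (fun _ => C * μ.real Set.univ)
    (fun N => (hmeas N).integral_prod_right.aestronglyMeasurable)
    (integrable_const _) (fun N => .of_forall fun x => ?_) (.of_forall fun x => ?_)
  · exact norm_integral_le_of_norm_le_const
      (.of_forall fun y => hC (s N x, s N y) (Set.mem_univ _))
  · refine tendsto_integral_of_dominated_convergence (fun _ => C) (fun N => ?_)
      (integrable_const C) (fun N => .of_forall fun y => hC (s N x, s N y) (Set.mem_univ _))
      (.of_forall fun y => ?_)
    · exact ((hmeas N).comp_measurable measurable_prodMk_left).aestronglyMeasurable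
    · exact (hkc.tendsto (x, y)).comp ((hs x).prodMk_nhds (hs y))

theorem IsGaussianProcess.integrable_prod_comp_simpleFunc
    [PseudoMetricSpace T] [CompactSpace T] [BorelSpace T]
    (hf : IsGaussianProcess f P) (hmeas : Measurable (Function.uncurry f))
    (hm : ∀ x, ∫ ω, f x ω ∂P = m x) (hk : ∀ x y, cov[f x, f y; P] = k x y)
    (hmc : Continuous m) (hkc : Continuous fun q : T × T => k q.1 q.2)
    (μ : Measure T) [IsFiniteMeasure μ] (s : SimpleFunc T T) :
    Integrable (fun q : T × Ω => f (s q.1) q.2) (μ.prod P) := by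
  have := hf.isProbabilityMeasure
  -- Composing with `s` amounts to integrating the original process against the pushforward measure.
  have h := hf.integrable_prod hmeas hm hk hmc hkc (μ.map s)
  have hp : MeasurePreserving s μ (μ.map s) := ⟨s.measurable, rfl⟩
  exact ((hp.prod (MeasurePreserving.id P)).integrable_comp h.aestronglyMeasurable).mpr h

theorem continuous_sqrt_increment [PseudoMetricSpace T] [CompactSpace T] [BorelSpace T]
    (hmc : Continuous m) (hkc : Continuous fun q : T × T => k q.1 q.2) :
    Continuous fun q : T × T =>
      √(k q.1 q.1 - 2 * k q.1 q.2 + k q.2 q.2 + (m q.1 - m q.2) ^ 2) := by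
  have h1 := hkc.comp (continuous_fst.prodMk (continuous_fst (X := T) (Y := T)))
  have h2 := hkc.comp (continuous_snd.prodMk (continuous_snd (X := T) (Y := T)))
  exact (((h1.sub (hkc.const_mul 2)).add h2).add
    (((hmc.comp continuous_fst).sub (hmc.comp continuous_snd)).pow 2)).sqrt

theorem IsGaussianProcess.integral_abs_integral_sub_le
    [PseudoMetricSpace T] [CompactSpace T] [BorelSpace T]
    (hf : IsGaussianProcess f P) (hmeas : Measurable (Function.uncurry f))
    (hm : ∀ x, ∫ ω, f x ω ∂P = m x) (hk : ∀ x y, cov[f x, f y; P] = k x y)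
    (hmc : Continuous m) (hkc : Continuous fun q : T × T => k q.1 q.2)
    (μ : Measure T) [IsFiniteMeasure μ] (s : SimpleFunc T T) :
    ∫ ω, |∫ x, f x ω ∂μ - ∫ x, f (s x) ω ∂μ| ∂P ≤
      ∫ x, √(k x x - 2 * k x (s x) + k (s x) (s x) + (m x - m (s x)) ^ 2) ∂μ := by
  have := hf.isProbabilityMeasure
  have hint := hf.integrable_prod hmeas hm hk hmc hkc μ
  have hintN := hf.integrable_prod_comp_simpleFunc hmeas hm hk hmc hkc μ s
  have hI : Integrable (fun ω => ∫ x, f x ω ∂μ) P := hint.integral_prod_right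
  have hIN : Integrable (fun ω => ∫ x, f (s x) ω ∂μ) P := hintN.integral_prod_right
  have hD := continuous_sqrt_increment hmc hkc
  have hsub : Integrable (fun q : T × Ω => |f q.1 q.2 - f (s q.1) q.2|) (μ.prod P) :=
    (hint.sub hintN).abs
  calc ∫ ω, |∫ x, f x ω ∂μ - ∫ x, f (s x) ω ∂μ| ∂P
      ≤ ∫ ω, ∫ x, |f x ω - f (s x) ω| ∂μ ∂P := by
        refine integral_mono_ae (hI.sub hIN).abs hsub.integral_prod_right ?_
        filter_upwards [hint.prod_left_ae, hintN.prod_left_ae] with ω h1 h2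
        have h := norm_integral_le_integral_norm (μ := μ) fun x => f x ω - f (s x) ω
        have e : ∫ x, (f x ω - f (s x) ω) ∂μ = ∫ x, f x ω ∂μ - ∫ x, f (s x) ω ∂μ :=
          integral_sub h1 h2
        rwa [e] at h
    _ = ∫ x, ∫ ω, |f x ω - f (s x) ω| ∂P ∂μ := (integral_integral_swap hsub).symm
    _ ≤ _ := by
        refine integral_mono hsub.integral_prod_left ?_
          fun x => hf.integral_abs_sub_le hm hk x (s x)
        obtain ⟨C, hC⟩ := isCompact_univ.exists_bound_of_continuousOn hD.continuousOn
        exact (integrable_const C).mono'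
          (hD.measurable.comp (measurable_id.prodMk s.measurable)).aestronglyMeasurable
          (.of_forall fun x => hC (x, s x) (Set.mem_univ _))

/-- The integral of a jointly measurable Gaussian process with continuous mean and covariance on a
compact metric space, against a finite measure, is Gaussian. -/
theorem IsGaussianProcess.map_integral [PseudoMetricSpace T] [CompactSpace T] [BorelSpace T]
    [Nonempty T] (hf : IsGaussianProcess f P) (hmeas : Measurable (Function.uncurry f))
    (hm : ∀ x, ∫ ω, f x ω ∂P = m x) (hk : ∀ x y, cov[f x, f y; P] = k x y)
    (hmc : Continuous m) (hkc : Continuous fun q : T × T => k q.1 q.2)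
    (μ : Measure T) [IsFiniteMeasure μ] :
    P.map (fun ω => ∫ x, f x ω ∂μ) =
      gaussianReal (∫ x, m x ∂μ) (∫ x, ∫ y, k x y ∂μ ∂μ).toNNReal := by
  have := hf.isProbabilityMeasure
  obtain ⟨x₀⟩ := ‹Nonempty T›
  obtain ⟨s, hs⟩ : ∃ s : ℕ → SimpleFunc T T, ∀ x, Tendsto (fun N => s N x) atTop (𝓝 x) :=
    ⟨SimpleFunc.approxOn id measurable_id Set.univ x₀ (Set.mem_univ _), fun x =>
      SimpleFunc.tendsto_approxOn measurable_id (Set.mem_univ x₀) (by simp)⟩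
  have hI : Integrable (fun ω => ∫ x, f x ω ∂μ) P :=
    (hf.integrable_prod hmeas hm hk hmc hkc μ).integral_prod_right
  have hIN (N : ℕ) : Integrable (fun ω => ∫ x, f (s N x) ω ∂μ) P :=
    (hf.integrable_prod_comp_simpleFunc hmeas hm hk hmc hkc μ (s N)).integral_prod_right
  -- The increment bound vanishes on the diagonal, so the simple-function integrals converge in
  -- `L¹`.
  have hlim : Tendsto (fun N => ∫ ω, |∫ x, f x ω ∂μ - ∫ x, f (s N x) ω ∂μ| ∂P) atTop (𝓝 0) := by
    have h := tendsto_integral_diag_approx μ hs (continuous_sqrt_increment hmc hkc)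
    have h0 : ∀ x, √(k x x - 2 * k x x + k x x + (m x - m x) ^ 2) = 0 := fun x => by
      rw [Real.sqrt_eq_zero']
      linarith
    simp only [h0, integral_zero] at h
    exact squeeze_zero (fun N => integral_nonneg fun ω => abs_nonneg _)
      (fun N => hf.integral_abs_integral_sub_le hmeas hm hk hmc hkc μ (s N)) h
  have := Measure.isProbabilityMeasure_map (μ := P) hI.aemeasurable
  refine Measure.ext_of_charFun (funext fun t => ?_)
  have hleft : Tendsto (fun N => charFun (P.map fun ω => ∫ x, f (s N x) ω ∂μ) t) atTop
      (𝓝 (charFun (P.map fun ω => ∫ x, f x ω ∂μ) t)) := by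
    rw [tendsto_iff_norm_sub_tendsto_zero]
    refine squeeze_zero (fun N => norm_nonneg _) (fun N => ?_)
      (by simpa using hlim.const_mul |t|)
    rw [norm_sub_rev]
    exact norm_charFun_map_sub_le hI (hIN N) t
  refine tendsto_nhds_unique hleft ?_
  have hmean : Tendsto (fun N => ((∫ x, m (s N x) ∂μ : ℝ) : ℂ)) atTop (𝓝 ↑(∫ x, m x ∂μ)) :=
    (Complex.continuous_ofReal.tendsto _).comp
      (tendsto_integral_diag_approx μ hs (hmc.comp continuous_snd))
  -- Continuity of `Real.toNNReal` makes it unnecessary to know that the double integral is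
  -- nonnegative.
  have hvar : Tendsto (fun N => (((∫ x, ∫ y, k (s N x) (s N y) ∂μ ∂μ).toNNReal : ℝ) : ℂ)) atTop
      (𝓝 ↑((∫ x, ∫ y, k x y ∂μ ∂μ).toNNReal : ℝ)) :=
    ((Complex.continuous_ofReal.comp
      (NNReal.continuous_coe.comp continuous_real_toNNReal)).tendsto _).comp
      (tendsto_integral_integral_approx μ hs hkc)
  simp_rw [hf.map_integral_comp_simpleFunc hm hk μ, charFun_gaussianReal]
  exact (((hmean.const_mul (t : ℂ)).mul_const Complex.I).sub
    ((hvar.mul_const ((t : ℂ) ^ 2)).div_const 2)).cexp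

end IntegralOfGaussianProcess

end ProbabilityTheory

/-! ### Kullback-Leibler divergence of real Gaussians. -/

namespace ProbabilityTheory

open scoped NNReal ENNReal

theorem integrable_sub_sq_gaussianReal (m c : ℝ) (v : ℝ≥0) :
    Integrable (fun x => (x - c) ^ 2) (gaussianReal m v) := by
  have h : MemLp (fun x : ℝ => x - c) 2 (gaussianReal m v) :=
    (memLp_id_gaussianReal 2).sub (memLp_const c)
  exact h.integrable_sq

theorem integral_sub_sq_gaussianReal (m c : ℝ) (v : ℝ≥0) :
    ∫ x, (x - c) ^ 2 ∂gaussianReal m v = v + (m - c) ^ 2 := by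
  have hid : MemLp (fun x : ℝ => x) 2 (gaussianReal m v) := memLp_id_gaussianReal 2
  have h : MemLp (fun x : ℝ => x - c) 2 (gaussianReal m v) := hid.sub (memLp_const c)
  have h1 := variance_eq_sub h
  rw [variance_sub_const hid.aestronglyMeasurable, variance_fun_id_gaussianReal,
    integral_sub (hid.integrable one_le_two) (integrable_const c), integral_id_gaussianReal] at h1
  simp only [Pi.pow_apply, integral_const, probReal_univ, one_smul] at h1
  linarith

theorem llr_gaussianReal {m₁ m₂ : ℝ} {v₁ v₂ : ℝ≥0} (h₁ : v₁ ≠ 0) (h₂ : v₂ ≠ 0) :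
    llr (gaussianReal m₂ v₂) (gaussianReal m₁ v₁) =ᵐ[gaussianReal m₂ v₂] fun x =>
      Real.log (√v₁ / √v₂) + (x - m₁) ^ 2 / (2 * v₁) - (x - m₂) ^ 2 / (2 * v₂) := by
  have hac := gaussianReal_absolutelyContinuous m₂ h₂
  -- The chain rule through Lebesgue measure turns the derivative into a quotient of densities.
  have hr : (gaussianReal m₂ v₂).rnDeriv (gaussianReal m₁ v₁) =ᵐ[volume]
      fun x => (gaussianPDF m₁ v₁ x)⁻¹ * (gaussianReal m₂ v₂).rnDeriv volume x := by
    rw [gaussianReal_of_var_ne_zero m₁ h₁]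
    exact Measure.rnDeriv_withDensity_right _ _ (measurable_gaussianPDF _ _).aemeasurable
      (Filter.Eventually.of_forall fun x => (gaussianPDF_pos _ h₁ x).ne')
      (Filter.Eventually.of_forall fun x => gaussianPDF_ne_top)
  filter_upwards [hac.ae_le hr, hac.ae_le (rnDeriv_gaussianReal m₂ v₂)] with x hx hx'
  have p₁ : (0 : ℝ) < v₁ := NNReal.coe_pos.mpr (pos_iff_ne_zero.mpr h₁)
  have p₂ : (0 : ℝ) < v₂ := NNReal.coe_pos.mpr (pos_iff_ne_zero.mpr h₂)
  rw [llr, hx, hx', ENNReal.toReal_mul, ENNReal.toReal_inv, toReal_gaussianPDF,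
    toReal_gaussianPDF, gaussianPDFReal, gaussianPDFReal,
    Real.sqrt_mul (x := 2 * Real.pi) (by positivity) v₁,
    Real.sqrt_mul (x := 2 * Real.pi) (by positivity) v₂]
  have e : ((√(2 * Real.pi) * √v₁)⁻¹ * Real.exp (-(x - m₁) ^ 2 / (2 * v₁)))⁻¹ *
      ((√(2 * Real.pi) * √v₂)⁻¹ * Real.exp (-(x - m₂) ^ 2 / (2 * v₂))) =
      √v₁ / √v₂ * Real.exp ((x - m₁) ^ 2 / (2 * v₁) - (x - m₂) ^ 2 / (2 * v₂)) := by
    rw [sub_eq_add_neg _ ((x - m₂) ^ 2 / (2 * (v₂ : ℝ))), Real.exp_add, ← neg_div,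
      neg_div _ ((x - m₁) ^ 2), Real.exp_neg]
    field_simp
  rw [e, Real.log_mul (by positivity) (Real.exp_ne_zero _), Real.log_exp]
  ring

theorem integrable_llr_gaussianReal {m₁ m₂ : ℝ} {v₁ v₂ : ℝ≥0} (h₁ : v₁ ≠ 0) (h₂ : v₂ ≠ 0) :
    Integrable (llr (gaussianReal m₂ v₂) (gaussianReal m₁ v₁)) (gaussianReal m₂ v₂) := by
  rw [integrable_congr (llr_gaussianReal h₁ h₂)]
  exact ((integrable_const _).add ((integrable_sub_sq_gaussianReal _ _ _).div_const _)).sub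
    ((integrable_sub_sq_gaussianReal _ _ _).div_const _)

theorem gaussianReal_absolutelyContinuous_gaussianReal {m₁ m₂ : ℝ} {v₁ v₂ : ℝ≥0}
    (h₁ : v₁ ≠ 0) (h₂ : v₂ ≠ 0) : gaussianReal m₂ v₂ ≪ gaussianReal m₁ v₁ :=
  (gaussianReal_absolutelyContinuous m₂ h₂).trans (gaussianReal_absolutelyContinuous' m₁ h₁)

theorem klDiv_gaussianReal_ne_top {m₁ m₂ : ℝ} {v₁ v₂ : ℝ≥0} (h₁ : v₁ ≠ 0) (h₂ : v₂ ≠ 0) :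
    InformationTheory.klDiv (gaussianReal m₂ v₂) (gaussianReal m₁ v₁) ≠ ⊤ :=
  InformationTheory.klDiv_ne_top (gaussianReal_absolutelyContinuous_gaussianReal h₁ h₂)
    (integrable_llr_gaussianReal h₁ h₂)

theorem toReal_klDiv_gaussianReal {m₁ m₂ : ℝ} {v₁ v₂ : ℝ≥0} (h₁ : v₁ ≠ 0) (h₂ : v₂ ≠ 0) :
    (InformationTheory.klDiv (gaussianReal m₂ v₂) (gaussianReal m₁ v₁)).toReal =
      Real.log (√v₁ / √v₂) + v₂ / (2 * v₁) + (m₂ - m₁) ^ 2 / (2 * v₁) - 1 / 2 := by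
  have i₁ := (integrable_sub_sq_gaussianReal m₂ m₁ v₂).div_const (2 * (v₁ : ℝ))
  have i₂ := (integrable_sub_sq_gaussianReal m₂ m₂ v₂).div_const (2 * (v₂ : ℝ))
  have i₀ : Integrable (fun x => Real.log (√v₁ / √v₂) + (x - m₁) ^ 2 / (2 * (v₁ : ℝ)))
      (gaussianReal m₂ v₂) := (integrable_const _).add i₁
  rw [InformationTheory.toReal_klDiv_of_measure_eq
    (gaussianReal_absolutelyContinuous_gaussianReal h₁ h₂) (by simp),
    integral_congr_ae (llr_gaussianReal h₁ h₂),
    integral_sub i₀ i₂,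
    integral_add (integrable_const _) i₁, integral_div, integral_div,
    integral_sub_sq_gaussianReal, integral_sub_sq_gaussianReal]
  have p₂ : (v₂ : ℝ) ≠ 0 := NNReal.coe_ne_zero.mpr h₂
  simp only [integral_const, probReal_univ, one_smul, sub_self]
  field_simp
  ring

end ProbabilityTheory

/-! ### The belief about the quantity of interest. -/

namespace BODE

variable {d n : ℕ}

section Density

variable {p : Cube d → ℝ}

/-- A nonintegrable function has integral `0` by convention, so total integral `1` forces
integrability. -/
theorem IsPdf.integrable (hp : IsPdf p) : Integrable p := by
  by_contra h
  have h1 := hp.integral_eq_one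
  rw [integral_undef h] at h1
  exact zero_ne_one h1

/-- The probability measure with density `p`. -/
noncomputable def pdfMeasure (p : Cube d → ℝ) : Measure (Cube d) :=
  volume.withDensity fun x => ENNReal.ofReal (p x)

theorem IsPdf.isProbabilityMeasure (hp : IsPdf p) : IsProbabilityMeasure (pdfMeasure p) := by
  constructor
  rw [pdfMeasure, withDensity_apply _ MeasurableSet.univ, Measure.restrict_univ,
    ← ofReal_integral_eq_lintegral_ofReal hp.integrable (Filter.Eventually.of_forall hp.nonneg),
    hp.integral_eq_one, ENNReal.ofReal_one]

theorem IsPdf.integral_pdfMeasure (hp : IsPdf p) (g : Cube d → ℝ) :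
    ∫ x, g x ∂pdfMeasure p = ∫ x, g x * p x := by
  rw [pdfMeasure, integral_withDensity_eq_integral_toReal_smul₀
    hp.integrable.aemeasurable.ennreal_ofReal
    (Filter.Eventually.of_forall fun x => ENNReal.ofReal_lt_top)]
  refine integral_congr_ae (Filter.Eventually.of_forall fun x => ?_)
  simp only [ENNReal.toReal_ofReal (hp.nonneg x), smul_eq_mul, mul_comm]

theorem IsPdf.qoi_eq (hp : IsPdf p) (g : Cube d → ℝ) : qoi p g = ∫ x, g x ∂pdfMeasure p :=
  (hp.integral_pdfMeasure g).symm

theorem IsPdf.qoiVar_eq (hp : IsPdf p) (θ : Hyper d) (X : Fin n → Cube d) :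
    qoiVar θ p X = ∫ x, ∫ y, postCov θ X x y ∂pdfMeasure p ∂pdfMeasure p := by
  rw [hp.integral_pdfMeasure, qoiVar]
  refine integral_congr_ae (Filter.Eventually.of_forall fun x => ?_)
  dsimp only
  rw [hp.integral_pdfMeasure, ← integral_mul_const]
  refine integral_congr_ae (Filter.Eventually.of_forall fun y => ?_)
  dsimp only
  ring

theorem IsPdf.kernelMean_eq (hp : IsPdf p) (θ : Hyper d) (x : Cube d) :
    kernelMean θ p x = ∫ y, kernel θ x y ∂pdfMeasure p :=
  (hp.integral_pdfMeasure _).symm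

/-- The law of the quantity of interest under a Gaussian process with continuous mean and
covariance functions. -/
theorem IsGP.map_qoi (hp : IsPdf p) {Ω : Type*} [MeasurableSpace Ω] {P : Measure Ω}
    {f : Cube d → Ω → ℝ} {m : Cube d → ℝ} {k : Cube d → Cube d → ℝ} (hf : IsGP P f m k)
    (hm : Continuous m) (hk : Continuous fun q : Cube d × Cube d => k q.1 q.2) :
    P.map (fun ω => qoi p fun x => f x ω) =
      gaussianReal (qoi p m) (∫ x, ∫ y, k x y ∂pdfMeasure p ∂pdfMeasure p).toNNReal := by
  have := hp.isProbabilityMeasure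
  simp_rw [hp.qoi_eq]
  exact hf.gaussian.map_integral hf.measurable hf.mean_eq hf.cov_eq hm hk _

theorem IsGP.map_qoi_eq_qoiBelief (hp : IsPdf p) {Ω : Type*} [MeasurableSpace Ω] {P : Measure Ω}
    {f : Cube d → Ω → ℝ} {θ : Hyper d} {X : Fin n → Cube d} {Y : Fin n → ℝ}
    (hf : IsGP P f (postMean θ X Y) (postCov θ X)) :
    P.map (fun ω => qoi p fun x => f x ω) = qoiBelief θ p X Y := by
  rw [hf.map_qoi hp (continuous_postMean θ X Y) (continuous_postCov θ X), qoiBelief, qoiMean,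
    hp.qoiVar_eq]

theorem continuous_kernel_left (θ : Hyper d) (y : Cube d) :
    Continuous fun x => kernel θ x y := by
  unfold kernel
  fun_prop

theorem continuous_kernel_right (θ : Hyper d) (x : Cube d) :
    Continuous fun y => kernel θ x y := by
  unfold kernel
  fun_prop

theorem integrable_of_continuous {F : Type*} [NormedAddCommGroup F] (μ : Measure (Cube d))
    [IsFiniteMeasure μ] {g : Cube d → F} (hg : Continuous g) : Integrable g μ :=
  hg.integrable_of_hasCompactSupport (HasCompactSupport.of_compactSpace _)

theorem IsPdf.integral_dotProduct_crossCov (hp : IsPdf p) (θ : Hyper d) (X : Fin n → Cube d)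
    (a : Fin n → ℝ) :
    ∫ x, a ⬝ᵥ crossCov θ X x ∂pdfMeasure p = a ⬝ᵥ fun i => kernelMean θ p (X i) := by
  have := hp.isProbabilityMeasure
  simp only [dotProduct, crossCov]
  rw [integral_finsetSum _ fun i _ =>
    (integrable_of_continuous _ (continuous_kernel_left θ (X i))).const_mul _]
  simp_rw [integral_const_mul, hp.kernelMean_eq, kernel_comm θ (X _)]

/-- This exhibits `ν` as the posterior covariance between `Q[f]` and `f(x̃)`, the reason it governs
the update of the mean. -/
theorem IsPdf.integral_postCov_left (hp : IsPdf p) (θ : Hyper d) (X : Fin n → Cube d)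
    (y : Cube d) : ∫ x, postCov θ X x y ∂pdfMeasure p = nu θ p X y := by
  have := hp.isProbabilityMeasure
  simp only [postCov]
  rw [integral_sub (integrable_of_continuous _ (continuous_kernel_left θ y))
    (integrable_of_continuous _ ((continuous_crossCov θ X).dotProduct continuous_const))]
  simp_rw [dotProduct_comm (crossCov θ X _)]
  rw [hp.integral_dotProduct_crossCov, dotProduct_comm, nu, hp.kernelMean_eq]
  simp_rw [kernel_comm θ y]

theorem IsPdf.integral_postCov_right (hp : IsPdf p) (θ : Hyper d) (X : Fin n → Cube d)
    (x : Cube d) : ∫ y, postCov θ X x y ∂pdfMeasure p = kernelMean θ p x -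
      crossCov θ X x ⬝ᵥ ((noisyGram θ X)⁻¹ *ᵥ fun i => kernelMean θ p (X i)) := by
  have := hp.isProbabilityMeasure
  simp only [postCov, dotProduct_mulVec]
  rw [integral_sub (integrable_of_continuous _ (continuous_kernel_right θ x))
    (integrable_of_continuous _ (continuous_const.dotProduct (continuous_crossCov θ X))),
    hp.integral_dotProduct_crossCov, hp.kernelMean_eq]

/-- The kernel mean embedding of the density `p`. -/
noncomputable def meanFeature (θ : Hyper d) (p : Cube d → ℝ) :
    Lp ℝ 2 (volume : Measure (Fin d → ℝ)) :=
  ∫ x, feature θ x ∂pdfMeasure p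

theorem IsPdf.inner_feature_meanFeature (hp : IsPdf p) (θ : Hyper d) (x : Cube d) :
    inner ℝ (feature θ x) (meanFeature θ p) = kernelMean θ p x := by
  have := hp.isProbabilityMeasure
  rw [meanFeature, ← integral_inner (integrable_of_continuous _ (continuous_feature θ)),
    hp.kernelMean_eq]
  simp_rw [inner_feature]

theorem IsPdf.kernelMean_pos (hp : IsPdf p) (θ : Hyper d) (x : Cube d) :
    0 < kernelMean θ p x := by
  have := hp.isProbabilityMeasure
  rw [hp.kernelMean_eq, integral_pos_iff_support_of_nonneg (fun y => (kernel_pos θ x y).le)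
    (integrable_of_continuous _ (continuous_kernel_right θ x)),
    Function.support_eq_univ fun y => (kernel_pos θ x y).ne']
  simp

theorem IsPdf.continuous_kernelMean (hp : IsPdf p) (θ : Hyper d) :
    Continuous (kernelMean θ p) := by
  rw [show kernelMean θ p = fun x => inner ℝ (feature θ x) (meanFeature θ p) from
    funext fun x => (hp.inner_feature_meanFeature θ x).symm]
  exact (continuous_feature θ).inner continuous_const

theorem IsPdf.inner_meanFeature_self (hp : IsPdf p) (θ : Hyper d) :
    inner ℝ (meanFeature θ p) (meanFeature θ p) = ∫ x, kernelMean θ p x ∂pdfMeasure p := by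
  have := hp.isProbabilityMeasure
  have h := integral_inner (𝕜 := ℝ)
    (integrable_of_continuous (pdfMeasure p) (continuous_feature θ)) (meanFeature θ p)
  rw [← meanFeature] at h
  rw [← h]
  simp_rw [real_inner_comm, hp.inner_feature_meanFeature]

/-- Puts the variance in the form to which the residual bound applies, with the mean embedding as
the vector. -/
theorem IsPdf.qoiVar_eq_residual (hp : IsPdf p) (θ : Hyper d) (X : Fin n → Cube d) :
    qoiVar θ p X = inner ℝ (meanFeature θ p) (meanFeature θ p) -
      (fun i => kernelMean θ p (X i)) ⬝ᵥ
        ((noisyGram θ X)⁻¹ *ᵥ fun i => kernelMean θ p (X i)) := by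
  have := hp.isProbabilityMeasure
  rw [hp.qoiVar_eq, hp.inner_meanFeature_self]
  simp_rw [hp.integral_postCov_right]
  rw [integral_sub (integrable_of_continuous _ (hp.continuous_kernelMean θ))
    (integrable_of_continuous _ ((continuous_crossCov θ X).dotProduct continuous_const))]
  simp_rw [dotProduct_comm (crossCov θ X _)]
  rw [hp.integral_dotProduct_crossCov, dotProduct_comm]

theorem IsPdf.qoiVar_pos (hp : IsPdf p) (θ : Hyper d) (X : Fin n → Cube d) :
    0 < qoiVar θ p X := by
  have h := noiseVar_mul_dotProduct_le_residual θ X (meanFeature θ p)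
    (fun i => kernelMean θ p (X i)) (fun i => (hp.inner_feature_meanFeature θ (X i)).symm)
  rw [← hp.qoiVar_eq_residual] at h
  by_cases hc : (noisyGram θ X)⁻¹ *ᵥ (fun i => kernelMean θ p (X i)) = 0
  · rw [hp.qoiVar_eq_residual, hc, dotProduct_zero, sub_zero]
    refine real_inner_self_pos.mpr fun h0 => ?_
    -- The point `0` is arbitrary: a vanishing embedding would contradict positivity of the kernel
    -- mean anywhere.
    have h1 := hp.inner_feature_meanFeature θ 0
    rw [h0, inner_zero_right] at h1
    exact (hp.kernelMean_pos θ 0).ne h1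
  · refine lt_of_lt_of_le (mul_pos θ.noiseVar_pos ?_) h
    simpa using dotProduct_self_star_pos_iff.mpr hc

end Density

/-! ### Rank-one update of the posterior mean. -/

section Update

theorem noisyGram_addDesign_mulVec (θ : Hyper d) (X : Fin n → Cube d) (xt : Cube d)
    (a : Fin n → ℝ) (s : ℝ) :
    noisyGram θ (addDesign X xt) *ᵥ addObs a s =
      addObs (noisyGram θ X *ᵥ a + s • crossCov θ X xt)
        (crossCov θ X xt ⬝ᵥ a + (kernel θ xt xt + θ.noiseVar) * s) := by
  ext i
  refine Fin.lastCases ?_ (fun i => ?_) i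
  · simp [mulVec, dotProduct, Fin.sum_univ_castSucc, noisyGram, addDesign, addObs, crossCov,
      Matrix.one_apply, (Fin.castSucc_lt_last _).ne']
  · simp [mulVec, dotProduct, Fin.sum_univ_castSucc, noisyGram, addDesign, addObs, crossCov,
      Matrix.one_apply, (Fin.castSucc_lt_last _).ne, kernel_comm θ xt, mul_comm]

theorem crossCov_addDesign_dotProduct (θ : Hyper d) (X : Fin n → Cube d) (xt x : Cube d)
    (a : Fin n → ℝ) (s : ℝ) :
    crossCov θ (addDesign X xt) x ⬝ᵥ addObs a s = crossCov θ X x ⬝ᵥ a + kernel θ x xt * s := by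
  simp [dotProduct, Fin.sum_univ_castSucc, addDesign, addObs, crossCov]

theorem postCov_add_noiseVar_pos (θ : Hyper d) (X : Fin n → Cube d) (x : Cube d) :
    0 < postCov θ X x x + θ.noiseVar :=
  add_pos_of_nonneg_of_pos (postCov_self_nonneg θ X x) θ.noiseVar_pos

/-- No block inverse is computed: the candidate solution is checked against the bordered system. Its
last entry is the innovation divided by the Schur complement `σ_n²(x̃) + σ²`, which is positive. -/
theorem inv_noisyGram_addDesign_mulVec (θ : Hyper d) (X : Fin n → Cube d) (Y : Fin n → ℝ)
    (xt : Cube d) (yt : ℝ) :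
    (noisyGram θ (addDesign X xt))⁻¹ *ᵥ addObs Y yt =
      addObs ((noisyGram θ X)⁻¹ *ᵥ Y -
          ((yt - postMean θ X Y xt) / (postCov θ X xt xt + θ.noiseVar)) •
            ((noisyGram θ X)⁻¹ *ᵥ crossCov θ X xt))
        ((yt - postMean θ X Y xt) / (postCov θ X xt xt + θ.noiseVar)) := by
  set s := (yt - postMean θ X Y xt) / (postCov θ X xt xt + θ.noiseVar) with hs
  have h : noisyGram θ (addDesign X xt) *ᵥ
      addObs ((noisyGram θ X)⁻¹ *ᵥ Y - s • ((noisyGram θ X)⁻¹ *ᵥ crossCov θ X xt)) s =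
      addObs Y yt := by
    rw [noisyGram_addDesign_mulVec]
    congr 1
    · rw [mulVec_sub, mulVec_smul, noisyGram_mulVec_inv_mulVec, noisyGram_mulVec_inv_mulVec,
        sub_add_cancel]
    · have h0 : s * (postCov θ X xt xt + θ.noiseVar) = yt - postMean θ X Y xt :=
        div_mul_cancel₀ _ (postCov_add_noiseVar_pos θ X xt).ne'
      rw [postCov, postMean] at h0
      rw [dotProduct_sub, dotProduct_smul, smul_eq_mul]
      linarith
  rw [← h, mulVec_mulVec, nonsing_inv_mul _ (isUnit_det_noisyGram θ _), one_mulVec]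

/-- The rank-one update of the posterior mean. -/
theorem postMean_addDesign (θ : Hyper d) (X : Fin n → Cube d) (Y : Fin n → ℝ)
    (xt : Cube d) (yt : ℝ) (x : Cube d) :
    postMean θ (addDesign X xt) (addObs Y yt) x = postMean θ X Y x +
      postCov θ X x xt *
        ((yt - postMean θ X Y xt) / (postCov θ X xt xt + θ.noiseVar)) := by
  rw [postMean, inv_noisyGram_addDesign_mulVec, crossCov_addDesign_dotProduct, dotProduct_sub,
    dotProduct_smul, smul_eq_mul]
  -- Only the covariance at `(x, x̃)` is unfolded; the variance in the denominator stays folded.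
  rw [← postMean, postCov.eq_1 θ X x xt]
  ring

theorem IsPdf.qoiMean_addDesign {p : Cube d → ℝ} (hp : IsPdf p) (θ : Hyper d)
    (X : Fin n → Cube d) (Y : Fin n → ℝ) (xt : Cube d) (yt : ℝ) :
    qoiMean θ p (addDesign X xt) (addObs Y yt) = qoiMean θ p X Y +
      nu θ p X xt / (postCov θ X xt xt + θ.noiseVar) * (yt - postMean θ X Y xt) := by
  have := hp.isProbabilityMeasure
  have hc : Continuous fun x => postCov θ X x xt :=
    (continuous_kernel_left θ xt).sub ((continuous_crossCov θ X).dotProduct continuous_const)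
  rw [qoiMean, qoiMean, hp.qoi_eq, hp.qoi_eq]
  simp_rw [postMean_addDesign]
  rw [integral_add (integrable_of_continuous _ (continuous_postMean θ X Y))
    ((integrable_of_continuous _ hc).mul_const _), integral_mul_const, hp.integral_postCov_left]
  ring

end Update

/-! ### Information gain and its predictive expectation. -/

section InformationGain

variable {p : Cube d → ℝ}

theorem IsPdf.infoDiv_ne_top (hp : IsPdf p) (θ : Hyper d) (X : Fin n → Cube d) (Y : Fin n → ℝ)
    (xt : Cube d) (yt : ℝ) : infoDiv θ p X Y xt yt ≠ ⊤ :=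
  klDiv_gaussianReal_ne_top (Real.toNNReal_pos.mpr (hp.qoiVar_pos θ X)).ne'
    (Real.toNNReal_pos.mpr (hp.qoiVar_pos θ _)).ne'

theorem IsPdf.qoiSd_sq (hp : IsPdf p) (θ : Hyper d) (X : Fin n → Cube d) :
    qoiSd θ p X ^ 2 = qoiVar θ p X :=
  Real.sq_sqrt (hp.qoiVar_pos θ X).le

theorem IsPdf.infoGain_eq (hp : IsPdf p) (θ : Hyper d) (X : Fin n → Cube d) (Y : Fin n → ℝ)
    (xt : Cube d) (yt : ℝ) :
    infoGain θ p X Y xt yt = Real.log (qoiSd θ p X / qoiSd θ p (addDesign X xt))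
      + qoiSd θ p (addDesign X xt) ^ 2 / (2 * qoiSd θ p X ^ 2)
      + (qoiMean θ p (addDesign X xt) (addObs Y yt) - qoiMean θ p X Y) ^ 2
        / (2 * qoiSd θ p X ^ 2) - 1 / 2 := by
  rw [infoGain, infoDiv, qoiBelief, qoiBelief,
    toReal_klDiv_gaussianReal (Real.toNNReal_pos.mpr (hp.qoiVar_pos θ X)).ne'
      (Real.toNNReal_pos.mpr (hp.qoiVar_pos θ _)).ne',
    Real.coe_toNNReal _ (hp.qoiVar_pos θ X).le, Real.coe_toNNReal _ (hp.qoiVar_pos θ _).le,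
    hp.qoiSd_sq, hp.qoiSd_sq, qoiSd, qoiSd]

/-- The square is centred at the predictive mean, so integrating it yields the predictive variance
alone. -/
theorem IsPdf.infoGain_eq_quadratic (hp : IsPdf p) (θ : Hyper d) (X : Fin n → Cube d)
    (Y : Fin n → ℝ) (xt : Cube d) (yt : ℝ) :
    infoGain θ p X Y xt yt = (Real.log (qoiSd θ p X / qoiSd θ p (addDesign X xt))
      + qoiSd θ p (addDesign X xt) ^ 2 / (2 * qoiSd θ p X ^ 2) - 1 / 2)
      + (nu θ p X xt / (postCov θ X xt xt + θ.noiseVar)) ^ 2 / (2 * qoiSd θ p X ^ 2)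
        * (yt - postMean θ X Y xt) ^ 2 := by
  rw [hp.infoGain_eq, hp.qoiMean_addDesign]
  ring

theorem predictive_eq (θ : Hyper d) (X : Fin n → Cube d) (Y : Fin n → ℝ) (xt : Cube d) :
    predictive θ X Y xt = gaussianReal (postMean θ X Y xt)
      (postCov θ X xt xt + θ.noiseVar).toNNReal := by
  rw [predictive, gaussianReal_conv_gaussianReal, add_zero,
    Real.toNNReal_add (postCov_self_nonneg θ X xt) θ.noiseVar_pos.le]

theorem IsPdf.integrable_infoGain (hp : IsPdf p) (θ : Hyper d) (X : Fin n → Cube d)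
    (Y : Fin n → ℝ) (xt : Cube d) :
    Integrable (infoGain θ p X Y xt) (predictive θ X Y xt) := by
  rw [predictive_eq, funext (hp.infoGain_eq_quadratic θ X Y xt)]
  exact (integrable_const _).add ((integrable_sub_sq_gaussianReal _ _ _).const_mul _)

theorem IsPdf.expectedInfoGain_eq (hp : IsPdf p) (θ : Hyper d) (X : Fin n → Cube d)
    (Y : Fin n → ℝ) (xt : Cube d) :
    expectedInfoGain θ p X Y xt = Real.log (qoiSd θ p X / qoiSd θ p (addDesign X xt))
      + qoiSd θ p (addDesign X xt) ^ 2 / (2 * qoiSd θ p X ^ 2) - 1 / 2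
      + nu θ p X xt ^ 2 / (2 * qoiSd θ p X ^ 2 * (postCov θ X xt xt + θ.noiseVar)) := by
  have hS := postCov_add_noiseVar_pos θ X xt
  rw [expectedInfoGain, predictive_eq, funext (hp.infoGain_eq_quadratic θ X Y xt),
    integral_add (integrable_const _) ((integrable_sub_sq_gaussianReal _ _ _).const_mul _),
    integral_const_mul, integral_sub_sq_gaussianReal, Real.coe_toNNReal _ hS.le]
  simp only [integral_const, probReal_univ, one_smul, sub_self]
  -- The predictive variance cancels one of the two powers in the squared update coefficient.
  field_simp
  ring

end InformationGain

end BODE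

theorem mainTheorem1 {d n : ℕ} (θ : BODE.Hyper d) (p : BODE.Cube d → ℝ) (hp : BODE.IsPdf p)
    (X : Fin n → BODE.Cube d) (Y : Fin n → ℝ) (xt : BODE.Cube d) :
    -- the beliefs about `Q` given `D_n`, and given `D_n` and `(x̃, ỹ)`, are the laws of `Q[f]`
    -- under the corresponding posterior Gaussian processes
    (∀ (Ω : Type*) [MeasurableSpace Ω] (P : Measure Ω) (f : BODE.Cube d → Ω → ℝ),
      BODE.IsGP P f (BODE.postMean θ X Y) (BODE.postCov θ X) →
        P.map (fun ω => BODE.qoi p (fun x => f x ω)) = BODE.qoiBelief θ p X Y) ∧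
    (∀ (yt : ℝ) (Ω : Type*) [MeasurableSpace Ω] (P : Measure Ω) (f : BODE.Cube d → Ω → ℝ),
      BODE.IsGP P f (BODE.postMean θ (BODE.addDesign X xt) (BODE.addObs Y yt))
          (BODE.postCov θ (BODE.addDesign X xt)) →
        P.map (fun ω => BODE.qoi p (fun x => f x ω)) =
          BODE.qoiBelief θ p (BODE.addDesign X xt) (BODE.addObs Y yt)) ∧
    -- all the quantities in the formulas are well defined
    0 < BODE.qoiVar θ p X ∧
    0 < BODE.qoiVar θ p (BODE.addDesign X xt) ∧
    0 ≤ BODE.postCov θ X xt xt ∧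
    -- the divergence is finite, given by the Gaussian formula, and quadratic in `ỹ`
    (∀ yt : ℝ, BODE.infoDiv θ p X Y xt yt ≠ ⊤ ∧
      BODE.infoGain θ p X Y xt yt =
        Real.log (BODE.qoiSd θ p X / BODE.qoiSd θ p (BODE.addDesign X xt))
          + BODE.qoiSd θ p (BODE.addDesign X xt) ^ 2 / (2 * BODE.qoiSd θ p X ^ 2)
          + (BODE.qoiMean θ p (BODE.addDesign X xt) (BODE.addObs Y yt)
              - BODE.qoiMean θ p X Y) ^ 2 / (2 * BODE.qoiSd θ p X ^ 2)
          - 1 / 2 ∧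
      BODE.qoiMean θ p (BODE.addDesign X xt) (BODE.addObs Y yt) =
        BODE.qoiMean θ p X Y
          + BODE.nu θ p X xt / (BODE.postCov θ X xt xt + θ.noiseVar)
            * (yt - BODE.postMean θ X Y xt)) ∧
    -- the expected information gain exists and has the closed form
    Integrable (BODE.infoGain θ p X Y xt) (BODE.predictive θ X Y xt) ∧
    BODE.expectedInfoGain θ p X Y xt =
      Real.log (BODE.qoiSd θ p X / BODE.qoiSd θ p (BODE.addDesign X xt))
        + BODE.qoiSd θ p (BODE.addDesign X xt) ^ 2 / (2 * BODE.qoiSd θ p X ^ 2)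
        - 1 / 2
        + BODE.nu θ p X xt ^ 2
          / (2 * BODE.qoiSd θ p X ^ 2 * (BODE.postCov θ X xt xt + θ.noiseVar)) := by
  exact ⟨fun _ _ _ _ hf => hf.map_qoi_eq_qoiBelief hp,
    fun _ _ _ _ _ hf => hf.map_qoi_eq_qoiBelief hp,
    hp.qoiVar_pos θ X, hp.qoiVar_pos θ _, BODE.postCov_self_nonneg θ X xt,
    fun yt => ⟨hp.infoDiv_ne_top θ X Y xt yt, hp.infoGain_eq θ X Y xt yt,
      hp.qoiMean_addDesign θ X Y xt yt⟩,
    hp.integrable_infoGain θ X Y xt, hp.expectedInfoGain_eq θ X Y xt⟩
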